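/- Let $\kappa$ be a (strongly) inaccessible cardinal which is a limit of inaccessible cardinals, i.e. for every cardinal $\mu<\kappa$ there is an inaccessible $\nu$ with $\mu<\nu<\kappa$. Let ${}^{\kappa>}2$ be the set of all $\{0,1\}$-valued sequences whose length $\lg(s)$ is an ordinal less than $\kappa$, ordered by end-extension $\subseteq$; let $s\wedge t$ denote the longest common initial segment of $s$ and $t$, and call $s,t$ incomparable if neither $s\subseteq t$ nor $t\subseteq s$. Let $\le_Q$ be the linear order on ${}^{\kappa>}2$ given by: $s\le_Q t$ if and only if $s=t$, or $t^\frown\langle 0\rangle\subseteq s$, or $s^\frown\langle 1\rangle\subseteq t$, or $s,t$ are incomparable with $(s\wedge t)^\frown\langle 0\rangle\subseteq s$ and $(s\wedge t)^\frown\langle 1\rangle\subseteq t$. A linear order $L$ is called $\kappa$-dense if for all $A,B\subseteq L$ of size less than $\kappa$ (possibly empty) such that $a<b$ for all $a\in A$ and $b\in B$, there is $c\in L$ with $a<c<b$ for all $a\in A$ and $b\in B$. A set $D\subseteq{}^{\kappa>}2$ is called diagonal if its elements are pairwise incomparable and distinct elements of its meet closure $\{s\wedge t: s,t\in D\}$ have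 different lengths. Let $S\subseteq{}^{\kappa>}2$ be such that $(S,\le_Q)$ is $\kappa$-dense. Then there is a diagonal set $D\subseteq S$ such that $(D,\le_Q)$ is $\kappa$-dense. -/

import Mathlib

universe u v

/-- A binary sequence of ordinal length: an ordinal `length` together with a function from
the set of smaller ordinals to `{0, 1}`; `false` stands for `0` and `true` for `1`. -/
structure BinSeq : Type (u + 1) where
  length : Ordinal.{u}
  val : Set.Iio length → Bool

namespace BinSeq

/-- `s ⊆ t`: the sequence `t` end-extends `s`. -/
instance : HasSubset BinSeq.{u} where
  Subset s t := ∃ h : s.length ≤ t.length,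
    ∀ β : Set.Iio s.length, t.val ⟨β.1, lt_of_lt_of_le β.2 h⟩ = s.val β

/-- The restriction of `s` to the ordinal `γ` (all of `s`, if `s` is not longer than `γ`). -/
noncomputable def restrict (s : BinSeq.{u}) (γ : Ordinal.{u}) : BinSeq.{u} where
  length := min γ s.length
  val β := s.val ⟨β.1, Set.mem_Iio.2 (lt_of_lt_of_le (Set.mem_Iio.1 β.2) (min_le_right _ _))⟩

open Classical in
/-- `s.snoc b` is the sequence `s` followed by the single digit `b`. -/
noncomputable def snoc (s : BinSeq.{u}) (b : Bool) : BinSeq.{u} where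
  length := Order.succ s.length
  val β := if h : β.1 < s.length then s.val ⟨β.1, h⟩ else b

/-- The meet of `s` and `t`: `s` cut off at the first place where `s` and `t` are not both
defined and equal. It is the longest common initial segment, see `subset_meet_iff`. -/
noncomputable def meet (s t : BinSeq.{u}) : BinSeq.{u} :=
  s.restrict (sInf {β | ¬ ∃ (hs : β < s.length) (ht : β < t.length),
    s.val ⟨β, hs⟩ = t.val ⟨β, ht⟩})

/-- Neither sequence is an end-extension of the other. -/
def Incomparable (s t : BinSeq.{u}) : Prop := ¬ s ⊆ t ∧ ¬ t ⊆ s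

/-- The lexicographic (partial) order. -/
def LexLT (s t : BinSeq.{u}) : Prop :=
  Incomparable s t ∧ (meet s t).snoc false ⊆ s ∧ (meet s t).snoc true ⊆ t

/-- The order `≤_Q` on binary sequences. -/
def QLE (s t : BinSeq.{u}) : Prop :=
  s = t ∨ t.snoc false ⊆ s ∨ s.snoc true ⊆ t ∨ (Incomparable s t ∧ LexLT s t)

/-! Proof that `QLE` is a linear order, and that `meet` is the longest common initial segment. -/

open Classical in
/-- The digit of `s` at place `β`, if there is one. -/
noncomputable def get (s : BinSeq.{u}) (β : Ordinal.{u}) : Option Bool :=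
  if h : β < s.length then some (s.val ⟨β, h⟩) else none

theorem get_of_lt {s : BinSeq.{u}} {β : Ordinal.{u}} (h : β < s.length) :
    s.get β = some (s.val ⟨β, h⟩) := dif_pos h

theorem get_of_le {s : BinSeq.{u}} {β : Ordinal.{u}} (h : s.length ≤ β) :
    s.get β = none := dif_neg h.not_gt

theorem get_eq_none_iff {s : BinSeq.{u}} {β : Ordinal.{u}} :
    s.get β = none ↔ s.length ≤ β := by
  refine ⟨fun h => ?_, get_of_le⟩
  by_contra hc
  rw [get_of_lt (not_le.1 hc)] at h
  cases h

theorem subset_iff_get {s t : BinSeq.{u}} :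
    s ⊆ t ↔ ∀ γ < s.length, t.get γ = s.get γ := by
  constructor
  · rintro ⟨h, h'⟩ γ hγ
    rw [get_of_lt hγ, get_of_lt (hγ.trans_le h)]
    exact congrArg some (h' ⟨γ, hγ⟩)
  · intro h
    have hl : s.length ≤ t.length := by
      by_contra hc
      have := h _ (not_le.1 hc)
      rw [get_of_le le_rfl, get_of_lt (not_le.1 hc)] at this
      cases this
    refine ⟨hl, fun β => ?_⟩
    have := h β.1 β.2
    rw [get_of_lt (lt_of_lt_of_le β.2 hl), get_of_lt β.2] at this
    exact Option.some.inj this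

theorem ext_get {s t : BinSeq.{u}} (h : ∀ γ, s.get γ = t.get γ) : s = t := by
  have hl : s.length = t.length := by
    apply le_antisymm
    · rw [← get_eq_none_iff, h, get_of_le le_rfl]
    · rw [← get_eq_none_iff, ← h, get_of_le le_rfl]
  obtain ⟨l, v⟩ := s
  obtain ⟨l', v'⟩ := t
  dsimp only at hl
  subst hl
  congr 1
  funext β
  have := h β.1
  rw [get_of_lt (s := ⟨l, v⟩) β.2, get_of_lt (s := ⟨l, v'⟩) β.2] at this
  exact Option.some.inj this

theorem subset_trans' {s t u : BinSeq.{u}} (h : s ⊆ t) (h' : t ⊆ u) : s ⊆ u := by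
  have hl := h.1
  rw [subset_iff_get] at h h' ⊢
  intro γ hγ
  rw [h' γ (hγ.trans_le hl), h γ hγ]

theorem subset_antisymm' {s t : BinSeq.{u}} (h : s ⊆ t) (h' : t ⊆ s) : s = t := by
  have hl := le_antisymm h.1 h'.1
  rw [subset_iff_get] at h
  apply ext_get
  intro γ
  rcases lt_or_ge γ s.length with hγ | hγ
  · exact (h γ hγ).symm
  · rw [get_of_le hγ, get_of_le (hl ▸ hγ)]

theorem snoc_subset_iff {s t : BinSeq.{u}} {b : Bool} :
    s.snoc b ⊆ t ↔ (∀ γ < s.length, t.get γ = s.get γ) ∧ t.get s.length = some b := by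
  have e1 : ∀ γ < s.length, (s.snoc b).get γ = s.get γ := by
    intro γ hγ
    rw [get_of_lt hγ, get_of_lt (s := s.snoc b) (hγ.trans (Order.lt_succ _))]
    exact congrArg some (dif_pos hγ)
  have e2 : (s.snoc b).get s.length = some b := by
    rw [get_of_lt (s := s.snoc b) (Order.lt_succ s.length)]
    exact congrArg some (dif_neg (lt_irrefl _))
  rw [subset_iff_get]
  constructor
  · intro h
    refine ⟨fun γ hγ => ?_, ?_⟩
    · rw [h γ (hγ.trans (Order.lt_succ _)), e1 γ hγ]
    · rw [h _ (Order.lt_succ _), e2]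
  · rintro ⟨h1, h2⟩ γ hγ
    rcases (Order.lt_succ_iff.1 hγ).lt_or_eq with h | h
    · rw [h1 γ h, e1 γ h]
    · rw [h, h2, e2]

theorem restrict_get (s : BinSeq.{u}) (γ β : Ordinal.{u}) (h : β < γ) :
    (s.restrict γ).get β = s.get β := by
  rcases lt_or_ge β s.length with h' | h'
  · rw [get_of_lt h', get_of_lt (s := s.restrict γ) (lt_min h h')]
    rfl
  · rw [get_of_le h', get_of_le (s := s.restrict γ) ((min_le_right _ _).trans h')]

theorem restrict_subset (s : BinSeq.{u}) (γ : Ordinal.{u}) : s.restrict γ ⊆ s :=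
  ⟨min_le_right _ _, fun _ => rfl⟩

theorem meet_spec (s t : BinSeq.{u}) :
    (∀ γ < (meet s t).length, s.get γ = t.get γ ∧ (meet s t).get γ = s.get γ) ∧
    (s.get (meet s t).length = t.get (meet s t).length → s.get (meet s t).length = none) := by
  set X : Set Ordinal.{u} := {β | ¬ ∃ (hs : β < s.length) (ht : β < t.length),
    s.val ⟨β, hs⟩ = t.val ⟨β, ht⟩} with hX
  have hne : s.length ∈ X := fun ⟨h, _⟩ => lt_irrefl _ h
  have hlen : (meet s t).length = sInf X := min_eq_left (csInf_le' hne)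
  rw [hlen]
  constructor
  · intro γ hγ
    have h1 := notMem_of_lt_csInf' hγ
    rw [hX, Set.mem_ofPred_eq, not_not] at h1
    obtain ⟨hs, ht, he⟩ := h1
    refine ⟨?_, restrict_get s _ γ hγ⟩
    rw [get_of_lt hs, get_of_lt ht, he]
  · intro h
    have h1 : sInf X ∈ X := csInf_mem ⟨_, hne⟩
    by_contra hc
    have hs : sInf X < s.length := by
      by_contra h2; exact hc (get_of_le (not_lt.1 h2))
    have ht : sInf X < t.length := by
      by_contra h2; exact hc (h.trans (get_of_le (not_lt.1 h2)))
    rw [get_of_lt hs, get_of_lt ht] at h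
    exact h1 ⟨hs, ht, Option.some.inj h⟩

theorem meet_subset_left (s t : BinSeq.{u}) : meet s t ⊆ s := restrict_subset _ _

theorem meet_subset_right (s t : BinSeq.{u}) : meet s t ⊆ t :=
  subset_iff_get.2 fun γ hγ => by
    obtain ⟨h1, h2⟩ := (meet_spec s t).1 γ hγ
    rw [h2, h1]

theorem subset_meet_iff {u s t : BinSeq.{u}} : u ⊆ meet s t ↔ u ⊆ s ∧ u ⊆ t := by
  refine ⟨fun h => ⟨subset_trans' h (meet_subset_left s t),
    subset_trans' h (meet_subset_right s t)⟩, fun ⟨hs, ht⟩ => ?_⟩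
  rw [subset_iff_get] at hs ht ⊢
  have hl : u.length ≤ (meet s t).length := by
    by_contra hc
    rw [not_le] at hc
    have h1 := (meet_spec s t).2 ((hs _ hc).trans (ht _ hc).symm)
    rw [hs _ hc, get_of_lt hc] at h1
    cases h1
  intro γ hγ
  rw [((meet_spec s t).1 γ (hγ.trans_le hl)).2, hs γ hγ]

/-- The order `0 < (undefined) < 1` of the possible digits. -/
def digitRank : Option Bool → ℕ
  | some false => 0
  | none => 1
  | some true => 2

theorem digitRank_injective : Function.Injective digitRank := by
  intro a b h
  rcases a with _ | _ | _ <;> rcases b with _ | _ | _ <;> simp_all [digitRank]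

/-- `t` lies above `s` at the first place where they differ. -/
def FirstDiffLT (s t : BinSeq.{u}) : Prop :=
  ∃ β, (∀ γ < β, s.get γ = t.get γ) ∧ digitRank (s.get β) < digitRank (t.get β)

theorem FirstDiffLT.irrefl (s : BinSeq.{u}) : ¬ FirstDiffLT s s :=
  fun ⟨_, _, h⟩ => lt_irrefl _ h

theorem FirstDiffLT.trans {s t u : BinSeq.{u}} (h : FirstDiffLT s t) (h' : FirstDiffLT t u) :
    FirstDiffLT s u := by
  obtain ⟨β, h1, h2⟩ := h
  obtain ⟨β', h1', h2'⟩ := h'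
  rcases lt_trichotomy β β' with hb | hb | hb
  · exact ⟨β, fun γ hγ => (h1 γ hγ).trans (h1' γ (hγ.trans hb)), by rw [← h1' β hb]; exact h2⟩
  · subst hb
    exact ⟨β, fun γ hγ => (h1 γ hγ).trans (h1' γ hγ), h2.trans h2'⟩
  · exact ⟨β', fun γ hγ => (h1 γ (hγ.trans hb)).trans (h1' γ hγ), by rw [h1 β' hb]; exact h2'⟩

theorem FirstDiffLT.trichotomy (s t : BinSeq.{u}) :
    FirstDiffLT s t ∨ s = t ∨ FirstDiffLT t s := by
  by_cases he : s = t
  · exact Or.inr (Or.inl he)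
  have hne : {β | s.get β ≠ t.get β}.Nonempty := by
    by_contra hc
    rw [Set.not_nonempty_iff_eq_empty] at hc
    refine he (ext_get fun γ => ?_)
    by_contra h
    exact (Set.eq_empty_iff_forall_notMem.1 hc γ) h
  have hlt : ∀ γ < sInf {β | s.get β ≠ t.get β}, s.get γ = t.get γ := fun γ hγ => by
    by_contra h
    exact notMem_of_lt_csInf' hγ h
  rcases lt_trichotomy (digitRank (s.get (sInf {β | s.get β ≠ t.get β})))
    (digitRank (t.get (sInf {β | s.get β ≠ t.get β}))) with h | h | h
  · exact Or.inl ⟨_, hlt, h⟩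
  · exact absurd (digitRank_injective h) (csInf_mem hne)
  · exact Or.inr (Or.inr ⟨_, fun γ hγ => (hlt γ hγ).symm, h⟩)

theorem FirstDiffLT.qle {s t : BinSeq.{u}} (h : FirstDiffLT s t) : QLE s t := by
  obtain ⟨β, h1, h2⟩ := h
  rcases hs : s.get β with _ | _ | _
  · have hsl : s.length ≤ β := get_eq_none_iff.1 hs
    have htl : t.get β = some true := by
      rcases ht : t.get β with _ | _ | _ <;> simp [hs, ht, digitRank] at h2 ⊢
    have : s.length = β := by
      refine hsl.antisymm ?_
      by_contra hc
      have h3 := h1 _ (not_le.1 hc)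
      rw [get_of_le le_rfl, eq_comm, get_eq_none_iff] at h3
      rw [get_of_le (h3.trans hsl)] at htl
      cases htl
    exact Or.inr (Or.inr (Or.inl (snoc_subset_iff.2
      ⟨fun γ hγ => (h1 γ (this ▸ hγ)).symm, this ▸ htl⟩)))
  · have hsl : β < s.length := by
      by_contra hc
      rw [get_of_le (not_lt.1 hc)] at hs
      cases hs
    rcases ht : t.get β with _ | _ | _
    · have htl := get_eq_none_iff.1 ht
      have : t.length = β := by
        refine htl.antisymm ?_
        by_contra hc
        have h3 := h1 _ (not_le.1 hc)
        rw [get_of_le (s := t) le_rfl, get_eq_none_iff] at h3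
        exact absurd (h3.trans htl) (not_le.2 hsl)
      exact Or.inr (Or.inl (snoc_subset_iff.2
        ⟨fun γ hγ => h1 γ (this ▸ hγ), this ▸ hs⟩))
    · simp [hs, ht, digitRank] at h2
    · have htl : β < t.length := by
        by_contra hc
        rw [get_of_le (not_lt.1 hc)] at ht
        cases ht
      have hinc : Incomparable s t := by
        constructor
        · intro h
          have := subset_iff_get.1 h β hsl
          rw [hs, ht] at this
          cases this
        · intro h
          have := subset_iff_get.1 h β htl
          rw [hs, ht] at this
          cases this
      have hm : (meet s t).length = β := by
        rcases lt_trichotomy (meet s t).length β with h | h | h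
        · have h3 := (meet_spec s t).2 (h1 _ h)
          rw [get_eq_none_iff] at h3
          exact absurd (h3.trans h.le) (not_le.2 hsl)
        · exact h
        · have h3 := ((meet_spec s t).1 β h).1
          rw [hs, ht] at h3
          cases h3
      refine Or.inr (Or.inr (Or.inr ⟨hinc, hinc, snoc_subset_iff.2 ⟨fun γ hγ => ?_, hm ▸ hs⟩,
        snoc_subset_iff.2 ⟨fun γ hγ => ?_, hm ▸ ht⟩⟩))
      · exact ((meet_spec s t).1 γ hγ).2.symm
      · exact (((meet_spec s t).1 γ hγ).2.trans ((meet_spec s t).1 γ hγ).1).symm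
  · rcases ht : t.get β with _ | _ | _ <;> simp [hs, ht, digitRank] at h2

theorem qle_iff {s t : BinSeq.{u}} : QLE s t ↔ s = t ∨ FirstDiffLT s t := by
  constructor
  · rintro (h | h | h | h)
    · exact Or.inl h
    · rw [snoc_subset_iff] at h
      exact Or.inr ⟨t.length, h.1, by rw [h.2, get_of_le le_rfl]; decide⟩
    · rw [snoc_subset_iff] at h
      exact Or.inr ⟨s.length, fun γ hγ => (h.1 γ hγ).symm, by
        rw [h.2, get_of_le le_rfl]; decide⟩
    · obtain ⟨-, -, h1, h2⟩ := h
      rw [snoc_subset_iff] at h1 h2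
      exact Or.inr ⟨(meet s t).length, fun γ hγ => (h1.1 γ hγ).trans (h2.1 γ hγ).symm, by
        rw [h1.2, h2.2]; decide⟩
  · rintro (h | h)
    · exact Or.inl h
    · exact h.qle

open Classical in
/-- From here on `≤` (and `<`) on binary sequences is the linear order `≤_Q`; end-extension is
written `⊆`. -/
noncomputable instance : LinearOrder BinSeq.{u} where
  le := QLE
  le_refl s := Or.inl rfl
  le_trans s t u h h' := by
    rw [qle_iff] at h h' ⊢
    rcases h with rfl | h
    · exact h'
    · rcases h' with rfl | h'
      · exact Or.inr h
      · exact Or.inr (h.trans h')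
  le_antisymm s t h h' := by
    rw [qle_iff] at h h'
    rcases h with h | h
    · exact h
    · rcases h' with h' | h'
      · exact h'.symm
      · exact absurd (h.trans h') (FirstDiffLT.irrefl _)
  le_total s t := by
    rw [qle_iff, qle_iff]
    rcases FirstDiffLT.trichotomy s t with h | h | h
    · exact Or.inl (Or.inr h)
    · exact Or.inl (Or.inl h)
    · exact Or.inr (Or.inr h)
  toDecidableLE := Classical.decRel _

end BinSeq

/-- The complete binary tree of height `κ`: all binary sequences of length less than `κ`. -/
def binTree (κ : Cardinal.{u}) : Set BinSeq.{u} := {s | s.length < κ.ord}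

/-- A linear order `L` is (strongly) `κ`-dense if for all subsets `A`, `B` of size less than `κ`
with `A < B` elementwise there is a point strictly between `A` and `B`. Here `A` or `B` may be
empty. The lifts only compare cardinals that live in different universes. -/
def IsKappaDense (κ : Cardinal.{u}) (L : Type v) [LinearOrder L] : Prop :=
  ∀ A B : Set L, Cardinal.lift.{u} (Cardinal.mk A) < Cardinal.lift.{v} κ →
    Cardinal.lift.{u} (Cardinal.mk B) < Cardinal.lift.{v} κ →
    (∀ a ∈ A, ∀ b ∈ B, a < b) → ∃ c : L, (∀ a ∈ A, a < c) ∧ (∀ b ∈ B, c < b)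

/-- The meet closure of a set of binary sequences. -/
def meetClosure (A : Set BinSeq.{u}) : Set BinSeq.{u} :=
  {u | ∃ s ∈ A, ∃ t ∈ A, u = BinSeq.meet s t}

/-- Distinct elements of `A` have different lengths. -/
def IsTransverse (A : Set BinSeq.{u}) : Prop :=
  ∀ s ∈ A, ∀ t ∈ A, s ≠ t → s.length ≠ t.length

/-- `A` is diagonal: its elements are pairwise incomparable under end-extension, and its meet
closure is transverse. -/
def IsDiagonal (A : Set BinSeq.{u}) : Prop :=
  (∀ s ∈ A, ∀ t ∈ A, s ≠ t → BinSeq.Incomparable s t) ∧ IsTransverse (meetClosure A)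

/-! The full tree `binTree κ` is itself `κ`-dense: by regularity fewer than `κ` nodes have bounded
length, and a cut of nodes shorter than `l` is filled by a branch of length `l`
(`exists_between_binTree`). So it suffices to embed this tree in `S` in an order-preserving way with
a diagonal image.

To each index `s` are attached a node `lower`, a longer node `upper` above the 1-successor of
`lower`, a point of `S` above the 0-successor of `upper`, and two intervals with end points in `S`:
one above the 0-successor of `lower`, one above the 1-successor of `upper`. Everything indexed
beyond `s` followed by 0 or by 1 stays in the corresponding interval. Cones are convex, so two
distinct points meet exactly in a `lower` or an `upper` node (`exists_split_of_lt`), and the order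
of the indices is preserved.

The data are chosen along a well-order of the indices that compares lengths first. Each `lower` is
longer than all earlier points, so different indices use disjoint ranges of lengths. The choice
never gets stuck (`exists_isChoice`): fewer than `κ` nested intervals leave a nontrivial interval,
and every interval of `S` splits above arbitrarily large lengths below `κ`
(`IsKappaDense.exists_split`). -/

namespace BinSeq

/-! ### First differences, cones and meets -/

theorem lt_iff_firstDiffLT {s t : BinSeq.{u}} : s < t ↔ FirstDiffLT s t := by
  constructor
  · intro h
    exact (qle_iff.1 h.le).resolve_left h.ne
  · intro h
    refine lt_of_le_of_ne h.qle ?_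
    rintro rfl
    exact FirstDiffLT.irrefl _ h

theorem length_lt_of_snoc_subset {s t : BinSeq.{u}} {b : Bool} (h : s.snoc b ⊆ t) :
    s.length < t.length := (Order.lt_succ _).trans_le h.1

theorem subset_of_snoc_subset {s t : BinSeq.{u}} {b : Bool} (h : s.snoc b ⊆ t) : s ⊆ t :=
  subset_iff_get.2 (snoc_subset_iff.1 h).1

/-- A sequence between two sequences that agree below `γ` agrees with them below `γ`. -/
theorem get_eq_of_mem_Icc {p q z : BinSeq.{u}} {γ : Ordinal.{u}}
    (h : ∀ β < γ, p.get β = q.get β) (hpz : p ≤ z) (hzq : z ≤ q) :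
    ∀ β < γ, z.get β = p.get β := by
  rcases hpz.eq_or_lt with rfl | hpz
  · exact fun _ _ => rfl
  rcases hzq.eq_or_lt with rfl | hzq
  · exact fun β hβ => (h β hβ).symm
  obtain ⟨β, h1, h2⟩ := lt_iff_firstDiffLT.1 hpz
  obtain ⟨β', h1', h2'⟩ := lt_iff_firstDiffLT.1 hzq
  have key : γ ≤ β ∨ γ ≤ β' := by
    by_contra! hc
    rcases lt_trichotomy β β' with hb | rfl | hb
    · rw [h1' β hb, h β hc.1] at h2
      exact lt_irrefl _ h2
    · rw [h β hc.1] at h2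
      exact lt_asymm h2 h2'
    · rw [← h1 β' hb, h β' hc.2] at h2'
      exact lt_irrefl _ h2'
  intro δ hδ
  rcases key with hb | hb
  · rw [← h1 δ (hδ.trans_le hb)]
  · rw [h1' δ (hδ.trans_le hb), h δ hδ]

/-- Cones under end-extension are convex. -/
theorem subset_of_mem_Icc {v p q z : BinSeq.{u}} (hp : v ⊆ p) (hq : v ⊆ q) (hpz : p ≤ z)
    (hzq : z ≤ q) : v ⊆ z := by
  rw [subset_iff_get] at hp hq ⊢
  intro γ hγ
  rw [get_eq_of_mem_Icc (fun β hβ => (hp β hβ).trans (hq β hβ).symm) hpz hzq γ hγ, hp γ hγ]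

theorem digitRank_le_of_lt {x y : BinSeq.{u}} {β : Ordinal.{u}}
    (h : ∀ γ < β, x.get γ = y.get γ) (hxy : x < y) :
    digitRank (x.get β) ≤ digitRank (y.get β) := by
  obtain ⟨δ, h1, h2⟩ := lt_iff_firstDiffLT.1 hxy
  rcases lt_trichotomy δ β with hd | rfl | hd
  · rw [h δ hd] at h2
    exact absurd h2 (lt_irrefl _)
  · exact h2.le
  · rw [h1 β hd]

theorem get_ne_of_lt {x y : BinSeq.{u}} {β : Ordinal.{u}}
    (h : ∀ γ < β, x.get γ = y.get γ) (hxy : x < y) (hn : x.get β = none ∨ y.get β = none) :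
    x.get β ≠ y.get β := by
  intro he
  have hx : x.length ≤ β := get_eq_none_iff.1 (hn.elim id fun h' => he.trans h')
  have hy : y.length ≤ β := get_eq_none_iff.1 (hn.elim (fun h' => he.symm.trans h') id)
  refine hxy.ne (ext_get fun γ => ?_)
  rcases lt_or_ge γ β with hγ | hγ
  · exact h γ hγ
  · rw [get_of_le (hx.trans hγ), get_of_le (hy.trans hγ)]

/-- Ranks of digits cannot decrease, and two missing digits would make the sequences equal. Hence a
point below one that ends at `β` or turns left there must itself turn left. -/
theorem get_eq_false_of_lt {x y : BinSeq.{u}} {β : Ordinal.{u}}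
    (h : ∀ γ < β, x.get γ = y.get γ) (hxy : x < y) (hy : y.get β ≠ some true) :
    x.get β = some false := by
  have h1 := digitRank_le_of_lt h hxy
  have h2 := get_ne_of_lt h hxy
  revert h1 h2 hy
  generalize x.get β = o
  generalize y.get β = o'
  rcases o with _ | _ | _ <;> rcases o' with _ | _ | _ <;> simp [digitRank]

theorem get_eq_true_of_lt {x y : BinSeq.{u}} {β : Ordinal.{u}}
    (h : ∀ γ < β, x.get γ = y.get γ) (hxy : x < y) (hx : x.get β ≠ some false) :
    y.get β = some true := by
  have h1 := digitRank_le_of_lt h hxy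
  have h2 := get_ne_of_lt h hxy
  revert h1 h2 hx
  generalize x.get β = o
  generalize y.get β = o'
  rcases o with _ | _ | _ <;> rcases o' with _ | _ | _ <;> simp [digitRank]

theorem lt_of_snoc_subset {m x y : BinSeq.{u}} (hx : m.snoc false ⊆ x) (hy : m.snoc true ⊆ y) :
    x < y := by
  rw [snoc_subset_iff] at hx hy
  rw [lt_iff_firstDiffLT]
  refine ⟨m.length, fun γ hγ => by rw [hx.1 γ hγ, hy.1 γ hγ], ?_⟩
  rw [hx.2, hy.2]
  decide

/-- If `x` and `y` pass through the two successors of `m`, then `m` is their meet. -/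
theorem meet_eq_of_snoc_subset {m x y : BinSeq.{u}} {b c : Bool} (hbc : b ≠ c)
    (hx : m.snoc b ⊆ x) (hy : m.snoc c ⊆ y) : meet x y = m := by
  refine subset_antisymm' ?_
    (subset_meet_iff.2 ⟨subset_of_snoc_subset hx, subset_of_snoc_subset hy⟩)
  rw [snoc_subset_iff] at hx hy
  have hl : (meet x y).length ≤ m.length := by
    by_contra! hc
    have := ((meet_spec x y).1 _ hc).1
    rw [hx.2, hy.2] at this
    exact hbc (Option.some.inj this)
  rw [subset_iff_get]
  intro γ hγ
  rw [((meet_spec x y).1 γ hγ).2, hx.1 γ (hγ.trans_le hl)]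

theorem incomparable_of_snoc_subset {m x y : BinSeq.{u}} {b c : Bool} (hbc : b ≠ c)
    (hx : m.snoc b ⊆ x) (hy : m.snoc c ⊆ y) : Incomparable x y := by
  have hx' := length_lt_of_snoc_subset hx
  have hy' := length_lt_of_snoc_subset hy
  rw [snoc_subset_iff] at hx hy
  refine ⟨fun h => ?_, fun h => ?_⟩
  · have := subset_iff_get.1 h _ hx'
    rw [hx.2, hy.2] at this
    exact hbc (Option.some.inj this).symm
  · have := subset_iff_get.1 h _ hy'
    rw [hx.2, hy.2] at this
    exact hbc (Option.some.inj this)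

theorem meet_self (x : BinSeq.{u}) : meet x x = x :=
  subset_antisymm' (meet_subset_left _ _)
    (subset_meet_iff.2 ⟨⟨le_rfl, fun _ => rfl⟩, ⟨le_rfl, fun _ => rfl⟩⟩)

theorem restrict_length {s : BinSeq.{u}} {γ : Ordinal.{u}} (h : γ ≤ s.length) :
    (s.restrict γ).length = γ := min_eq_left h

theorem restrict_congr {s t : BinSeq.{u}} {γ : Ordinal.{u}} (h : ∀ β < γ, s.get β = t.get β) :
    s.restrict γ = t.restrict γ := by
  have hlen : ∀ s' : BinSeq.{u}, (s'.restrict γ).length ≤ γ := fun s' => min_le_left _ _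
  refine ext_get fun β => ?_
  rcases lt_or_ge β γ with hβ | hβ
  · rw [restrict_get _ _ _ hβ, restrict_get _ _ _ hβ, h β hβ]
  · rw [get_of_le ((hlen s).trans hβ), get_of_le ((hlen t).trans hβ)]

theorem get_eq_of_restrict_eq {s t : BinSeq.{u}} {γ : Ordinal.{u}}
    (h : s.restrict γ = t.restrict γ) {β : Ordinal.{u}} (hβ : β < γ) : s.get β = t.get β := by
  rw [← restrict_get s γ β hβ, h, restrict_get t γ β hβ]

theorem restrict_restrict (s : BinSeq.{u}) {γ δ : Ordinal.{u}} (h : γ ≤ δ) :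
    (s.restrict δ).restrict γ = s.restrict γ :=
  restrict_congr fun β hβ => restrict_get s δ β (hβ.trans_le h)

/-- The sequence of length `l` with digits `f`. -/
def ofFun (l : Ordinal.{u}) (f : Ordinal.{u} → Bool) : BinSeq.{u} := ⟨l, fun β => f β⟩

theorem get_ofFun {l : Ordinal.{u}} {f : Ordinal.{u} → Bool} {β : Ordinal.{u}} (h : β < l) :
    (ofFun l f).get β = some (f β) := get_of_lt (s := ofFun l f) h

/-! ### Small sets of sequences, and density of the full tree -/

/-- A sequence is determined by its length and the set of places with digit 1; `κ` is a strong
limit. -/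
theorem mk_setOf_length_le_lt {κ : Cardinal.{u}} (hκ : κ.IsInaccessible) {l : Ordinal.{u}}
    (hl : l < κ.ord) : Cardinal.mk {t : BinSeq.{u} | t.length ≤ l} < Cardinal.lift.{u + 1} κ := by
  have hI : Cardinal.mk (Set.Iio (Order.succ l)) < Cardinal.lift.{u + 1} κ := by
    rw [Cardinal.mk_Iio_ordinal, Cardinal.lift_lt, ← Cardinal.lt_ord]
    exact (Cardinal.isSuccLimit_ord hκ.aleph0_lt.le).succ_lt hl
  have h0 : Cardinal.aleph0 ≤ Cardinal.lift.{u + 1} κ := by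
    simpa using hκ.aleph0_lt.le
  have hinj : Function.Injective
      (fun t : {t : BinSeq.{u} | t.length ≤ l} =>
        ((⟨t.1.length, Set.mem_Iio.2 (Order.lt_succ_iff.2 t.2)⟩, {β | t.1.get β.1 = some true}) :
          Set.Iio (Order.succ l) × Set (Set.Iio (Order.succ l)))) := by
    rintro ⟨s, hs⟩ ⟨t, ht⟩ h
    simp only [Prod.mk.injEq, Subtype.mk.injEq] at h
    obtain ⟨h1, h2⟩ := h
    refine Subtype.ext (ext_get fun γ => ?_)
    rcases lt_or_ge γ s.length with hγ | hγ
    · have h3 := Set.ext_iff.1 h2 ⟨γ, Set.mem_Iio.2 (Order.lt_succ_iff.2 (hγ.le.trans hs))⟩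
      simp only [Set.mem_ofPred_eq] at h3
      rw [get_of_lt hγ, get_of_lt (h1 ▸ hγ)] at h3 ⊢
      simp only [Option.some.injEq] at h3 ⊢
      exact Bool.eq_iff_iff.2 h3
    · rw [get_of_le hγ, get_of_le (h1 ▸ hγ)]
  refine (Cardinal.mk_le_of_injective hinj).trans_lt ?_
  rw [Cardinal.mk_prod, Cardinal.lift_id, Cardinal.lift_id, Cardinal.mk_set]
  refine Cardinal.mul_lt_of_lt h0 hI ?_
  obtain ⟨c, hc, hcI⟩ := Cardinal.lt_lift_iff.1 hI
  rw [← hcI, ← Cardinal.lift_two_power, Cardinal.lift_lt]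
  exact hκ.isStrongPrelimit hc

theorem exists_length_bound {κ : Cardinal.{u}} (hκ : κ.IsInaccessible) {X : Set BinSeq.{u}}
    (hX : Cardinal.mk X < Cardinal.lift.{u + 1} κ) {f : BinSeq.{u} → Ordinal.{u}}
    (hf : ∀ x ∈ X, f x < κ.ord) : ∃ l < κ.ord, ∀ x ∈ X, f x < l := by
  -- `X` lives one universe up; it is reindexed by a type in the universe of the ordinals so that
  -- regularity of `κ` bounds the supremum.
  obtain ⟨c, hc, hcX⟩ := Cardinal.lt_lift_iff.1 hX
  obtain ⟨e⟩ : Nonempty (c.out ≃ X) := by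
    rw [← Cardinal.lift_mk_eq'.{u, u + 1}, Cardinal.mk_out, hcX, Cardinal.lift_id'.{u, u + 1}]
  refine ⟨⨆ i : c.out, (f (e i).1 + 1), ?_, fun x hx => ?_⟩
  · refine Ordinal.iSup_add_one_lt_of_lt_cof ?_ fun i => hf _ (e i).2
    rw [Cardinal.mk_out]
    exact hc.trans_le hκ.le_cof_ord
  · have := Ordinal.lt_iSup_add_one (fun i : c.out => f (e i).1) (e.symm ⟨x, hx⟩)
    simpa using this

/-- The complete binary tree of inaccessible height is dense. -/
theorem exists_between_binTree {l : Ordinal.{u}} {A B : Set BinSeq.{u}}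
    (hA : ∀ a ∈ A, a.length < l) (hB : ∀ b ∈ B, b.length < l) (hAB : ∀ a ∈ A, ∀ b ∈ B, a < b) :
    ∃ c : BinSeq.{u}, c.length = l ∧ (∀ a ∈ A, a < c) ∧ ∀ b ∈ B, c < b := by
  classical
  -- The leftmost branch above `A`: it turns right exactly when some `a ∈ A` has followed it so far
  -- and does not turn left.
  let step : ∀ β : Ordinal.{u}, (∀ γ, γ < β → Bool) → Bool := fun β f =>
    decide (∃ a ∈ A, (∀ γ (h : γ < β), a.get γ = some (f γ h)) ∧ a.get β ≠ some false)
  let c : Ordinal.{u} → Bool := (wellFounded_lt (α := Ordinal.{u})).fix step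
  have hc : ∀ β, c β = true ↔
      ∃ a ∈ A, (∀ γ < β, a.get γ = some (c γ)) ∧ a.get β ≠ some false := by
    intro β
    have : c β = step β fun γ _ => c γ := WellFounded.fix_eq _ _ _
    rw [this]
    exact decide_eq_true_iff
  have first : ∀ x : BinSeq.{u}, x.length < l → ∃ β < l, (∀ γ < β, x.get γ = some (c γ)) ∧
      x.get β ≠ some (c β) := by
    intro x hx
    have hne : x.get x.length ≠ some (c x.length) := by
      rw [get_of_le le_rfl]
      exact nofun
    obtain ⟨β, h1, h2⟩ := (wellFounded_lt (α := Ordinal.{u})).has_min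
      {β | x.get β ≠ some (c β)} ⟨_, hne⟩
    refine ⟨β, (not_lt.1 (h2 _ hne)).trans_lt hx, fun γ hγ => ?_, h1⟩
    by_contra h
    exact h2 γ h hγ
  refine ⟨ofFun l c, rfl, fun a ha => ?_, fun b hb => ?_⟩
  · obtain ⟨β, hβ, h1, h2⟩ := first a (hA a ha)
    rw [lt_iff_firstDiffLT]
    refine ⟨β, fun γ hγ => by rw [h1 γ hγ, get_ofFun (hγ.trans hβ)], ?_⟩
    have h3 : c β = true := by
      by_contra h
      refine h ((hc β).2 ⟨a, ha, h1, ?_⟩)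
      rw [Bool.not_eq_true] at h
      rwa [h] at h2
    rw [get_ofFun hβ, h3]
    rw [h3] at h2
    rcases h : a.get β with _ | _ | _
    · decide
    · decide
    · exact absurd h h2
  · obtain ⟨β, hβ, h1, h2⟩ := first b (hB b hb)
    cases h3 : c β with
    | false =>
      rw [lt_iff_firstDiffLT]
      refine ⟨β, fun γ hγ => by rw [h1 γ hγ, get_ofFun (hγ.trans hβ)], ?_⟩
      rw [get_ofFun hβ, h3]
      rw [h3] at h2
      rcases h : b.get β with _ | _ | _
      · decide
      · exact absurd h h2
      · decide
    | true =>
      -- The `a` that forced the right turn at `β` agrees with `b` below `β` and has a digit there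
      -- of rank at least that of `b`, against `a < b`.
      exfalso
      obtain ⟨a, ha, h4, h5⟩ := (hc β).1 h3
      obtain ⟨β', h6, h7⟩ := lt_iff_firstDiffLT.1 (hAB a ha b hb)
      rcases lt_trichotomy β' β with h | rfl | h
      · rw [h4 _ h, h1 _ h] at h7
        exact lt_irrefl _ h7
      · rw [h3] at h2
        rcases ha' : a.get β' with _ | _ | _ <;> rcases hb' : b.get β' with _ | _ | _ <;>
          simp_all [digitRank]
      · have h8 := h6 β h
        rw [h3] at h2
        rcases ha' : a.get β with _ | _ | _
        · have e1 : a.length ≤ β := get_eq_none_iff.1 ha'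
          have e2 : b.length ≤ β := get_eq_none_iff.1 (h8 ▸ ha')
          rw [get_of_le (e1.trans h.le), get_of_le (e2.trans h.le)] at h7
          exact lt_irrefl _ h7
        · exact h5 ha'
        · exact h2 (h8 ▸ ha')

end BinSeq

open BinSeq

/-! ### Intervals of a dense set -/

theorem isKappaDense_coe_iff {κ : Cardinal.{u}} {S : Set BinSeq.{u}} :
    IsKappaDense κ S ↔ ∀ A B : Set BinSeq.{u}, A ⊆ S → B ⊆ S →
      Cardinal.mk A < Cardinal.lift.{u + 1} κ → Cardinal.mk B < Cardinal.lift.{u + 1} κ →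
      (∀ a ∈ A, ∀ b ∈ B, a < b) → ∃ c ∈ S, (∀ a ∈ A, a < c) ∧ ∀ b ∈ B, c < b := by
  have hl : ∀ X : Set S, Cardinal.lift.{u} (Cardinal.mk X) = Cardinal.mk X :=
    fun X => Cardinal.lift_id'.{u, u + 1} _
  have hp : ∀ X ⊆ S, Cardinal.mk ((↑) ⁻¹' X : Set S) = Cardinal.mk X := fun X hX =>
    Cardinal.mk_preimage_of_injective_of_subset_range _ _ Subtype.val_injective (by simpa using hX)
  constructor
  · intro h A B hAS hBS hA hB hAB
    obtain ⟨c, h1, h2⟩ := h ((↑) ⁻¹' A) ((↑) ⁻¹' B) (by rwa [hl, hp A hAS])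
      (by rwa [hl, hp B hBS]) fun a ha b hb => hAB _ ha _ hb
    exact ⟨c, c.2, fun a ha => h1 ⟨a, hAS ha⟩ ha, fun b hb => h2 ⟨b, hBS hb⟩ hb⟩
  · intro h A B hA hB hAB
    rw [hl] at hA hB
    obtain ⟨c, hc, h1, h2⟩ := h ((↑) '' A) ((↑) '' B) (by simp) (by simp)
      (Cardinal.mk_image_le.trans_lt hA) (Cardinal.mk_image_le.trans_lt hB) (by
        rintro _ ⟨a, ha, rfl⟩ _ ⟨b, hb, rfl⟩
        exact hAB a ha b hb)
    exact ⟨⟨c, hc⟩, fun a ha => h1 _ ⟨a, ha, rfl⟩, fun b hb => h2 _ ⟨b, hb, rfl⟩⟩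

section Dense

variable {κ : Cardinal.{u}} {S : Set BinSeq.{u}}

theorem IsKappaDense.exists_between (hκ : κ.IsInaccessible) (hS : IsKappaDense κ S)
    {a b : BinSeq.{u}} (ha : a ∈ S) (hb : b ∈ S) (hab : a < b) : ∃ c ∈ S, a < c ∧ c < b := by
  have h1 : (1 : Cardinal.{u + 1}) < Cardinal.lift.{u + 1} κ := by
    simpa using Cardinal.one_lt_aleph0.trans hκ.aleph0_lt
  obtain ⟨c, hc, h2, h3⟩ := isKappaDense_coe_iff.1 hS {a} {b} (by simpa) (by simpa)
    (by simpa using h1) (by simpa using h1) (by simpa)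
  exact ⟨c, hc, h2 a rfl, h3 b rfl⟩

/-- Pigeonhole: the interval has at least `κ` points, but there are fewer than `κ` sequences of
length at most `l`. -/
theorem IsKappaDense.exists_restrict_eq (hκ : κ.IsInaccessible) (hS : IsKappaDense κ S)
    {a b : BinSeq.{u}} (ha : a ∈ S) (hb : b ∈ S) (hab : a < b) {l : Ordinal.{u}}
    (hl : l < κ.ord) :
    ∃ x ∈ S, ∃ y ∈ S, a < x ∧ x < y ∧ y < b ∧ x.restrict l = y.restrict l := by
  set L : Set BinSeq.{u} := {x | x ∈ S ∧ a < x ∧ x < b} with hL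
  have h0 : Cardinal.aleph0 < Cardinal.lift.{u + 1} κ := by simpa using hκ.aleph0_lt
  have hLκ : Cardinal.lift.{u + 1} κ ≤ Cardinal.mk L := by
    by_contra! hc
    -- A small interval could be topped by a further point `c < b`. With `a` on the left side, `c`
    -- lies in the interval as well and hence above itself.
    obtain ⟨c, hc, h1, h2⟩ := isKappaDense_coe_iff.1 hS (insert a L) {b}
      (by rintro x (rfl | hx); exacts [ha, hx.1]) (by simpa)
      (Cardinal.mk_insert_le.trans_lt
        (Cardinal.add_lt_of_lt h0.le hc (Cardinal.one_lt_aleph0.trans h0)))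
      (by simpa using Cardinal.one_lt_aleph0.trans hκ.aleph0_lt)
      (by rintro x (rfl | hx) y rfl; exacts [hab, hx.2.2])
    exact lt_irrefl c (h1 c (Or.inr ⟨hc, h1 a (Or.inl rfl), h2 b rfl⟩))
  have hni : ¬ Function.Injective
      (fun x : L => (⟨x.1.restrict l, show (x.1.restrict l).length ≤ l from min_le_left _ _⟩ :
        {t : BinSeq.{u} | t.length ≤ l})) :=
    fun h => ((hLκ.trans (Cardinal.mk_le_of_injective h)).trans_lt
      (mk_setOf_length_le_lt hκ hl)).false
  simp only [Function.Injective, not_forall] at hni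
  obtain ⟨x, y, hxy, hne⟩ := hni
  have hxy : x.1.restrict l = y.1.restrict l := congrArg Subtype.val hxy
  rcases lt_or_gt_of_ne (fun h => hne (Subtype.ext h) : x.1 ≠ y.1) with h | h
  · exact ⟨x, x.2.1, y, y.2.1, x.2.2.1, h, y.2.2.2, hxy⟩
  · exact ⟨y, y.2.1, x, x.2.1, y.2.2.1, h, x.2.2.2, hxy.symm⟩

/-- Every interval of a dense set contains nontrivial intervals in the two cones above some
arbitrarily long sequence. -/
theorem IsKappaDense.exists_split (hκ : κ.IsInaccessible) (hS : IsKappaDense κ S)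
    {a b : BinSeq.{u}} (ha : a ∈ S) (hb : b ∈ S) (hab : a < b) {l : Ordinal.{u}}
    (hl : l < κ.ord) :
    ∃ m : BinSeq.{u}, l ≤ m.length ∧ ∀ c : Bool, ∃ p ∈ S, ∃ q ∈ S,
      a < p ∧ p < q ∧ q < b ∧ m.snoc c ⊆ p ∧ m.snoc c ⊆ q := by
  obtain ⟨x, hx, y, hy, hax, hxy, hyb, hres⟩ := hS.exists_restrict_eq hκ ha hb hab hl
  -- The places where two points of `S` between `x` and `y` first differ. At the least such place
  -- `β` all these points share their digits below `β`, and `β ≥ l` because `x` and `y` agree below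
  -- `l`. The splitting node is this common part.
  set X : Set Ordinal.{u} := {β | ∃ z w : BinSeq.{u}, z ∈ S ∧ w ∈ S ∧ x < z ∧ z < w ∧ w < y ∧
    (∀ γ < β, z.get γ = w.get γ) ∧ digitRank (z.get β) < digitRank (w.get β)} with hX
  have hne : X.Nonempty := by
    obtain ⟨z, hz, hxz, hzy⟩ := hS.exists_between hκ hx hy hxy
    obtain ⟨w, hw, hzw, hwy⟩ := hS.exists_between hκ hz hy hzy
    obtain ⟨β, h1, h2⟩ := lt_iff_firstDiffLT.1 hzw
    exact ⟨β, z, w, hz, hw, hxz, hzw, hwy, h1, h2⟩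
  obtain ⟨β, ⟨z, w, hz, hw, hxz, hzw, hwy, h1, h2⟩, hmin⟩ :=
    (wellFounded_lt (α := Ordinal.{u})).has_min X hne
  have agree : ∀ v ∈ S, x < v → v < y → ∀ γ < β, v.get γ = z.get γ := by
    intro v hv hxv hvy γ hγ
    rcases lt_trichotomy v z with h | rfl | h
    · obtain ⟨δ, h3, h4⟩ := lt_iff_firstDiffLT.1 h
      have : β ≤ δ := not_lt.1 (hmin δ ⟨v, z, hv, hz, hxv, h, hzw.trans hwy, h3, h4⟩)
      exact h3 γ (hγ.trans_le this)
    · rfl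
    · obtain ⟨δ, h3, h4⟩ := lt_iff_firstDiffLT.1 h
      have : β ≤ δ := not_lt.1 (hmin δ ⟨z, v, hz, hv, hxz, h, hvy, h3, h4⟩)
      exact (h3 γ (hγ.trans_le this)).symm
  have hlβ : l ≤ β := by
    by_contra! hc
    have hres' : ∀ γ < l, x.get γ = y.get γ := fun γ hγ => get_eq_of_restrict_eq hres hγ
    rw [get_eq_of_mem_Icc hres' hxz.le (hzw.trans hwy).le β hc,
      get_eq_of_mem_Icc hres' (hxz.trans hzw).le hwy.le β hc] at h2
    exact lt_irrefl _ h2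
  have hβz : β ≤ z.length := by
    by_contra! hc
    have h3 := h1 _ hc
    rw [get_of_le le_rfl, eq_comm, get_eq_none_iff] at h3
    rw [get_of_le hc.le, get_of_le (h3.trans hc.le)] at h2
    exact lt_irrefl _ h2
  have hm : (z.restrict β).length = β := restrict_length hβz
  have hsnoc : ∀ (c : Bool) (v : BinSeq.{u}), v ∈ S → x < v → v < y → v.get β = some c →
      (z.restrict β).snoc c ⊆ v := by
    intro c v hv hxv hvy hvc
    rw [snoc_subset_iff, hm]
    exact ⟨fun γ hγ => by rw [agree v hv hxv hvy γ hγ, restrict_get _ _ _ hγ], hvc⟩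
  refine ⟨z.restrict β, hlβ.trans hm.ge, fun c => ?_⟩
  cases c with
  | false =>
    have hzβ : z.get β ≠ some true := fun h3 => by
      rcases h4 : w.get β with _ | _ | _ <;> simp [h3, h4, digitRank] at h2
    -- `z` itself may end at `β`, but all points of `S` between `x` and `z` turn left there. The
    -- other case uses the points above `w` in the same way.
    obtain ⟨q, hq, hxq, hqz⟩ := hS.exists_between hκ hx hz hxz
    obtain ⟨p, hp, hxp, hpq⟩ := hS.exists_between hκ hx hq hxq
    have hzy := hzw.trans hwy
    have key : ∀ v ∈ S, x < v → v < z → (z.restrict β).snoc false ⊆ v := fun v hv hxv hvz =>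
      hsnoc _ v hv hxv (hvz.trans hzy)
        (get_eq_false_of_lt (agree v hv hxv (hvz.trans hzy)) hvz hzβ)
    exact ⟨p, hp, q, hq, hax.trans hxp, hpq, (hqz.trans hzy).trans hyb,
      key p hp hxp (hpq.trans hqz), key q hq hxq hqz⟩
  | true =>
    have hwβ : w.get β ≠ some false := fun h3 => by simp [h3, digitRank] at h2
    obtain ⟨p, hp, hwp, hpy⟩ := hS.exists_between hκ hw hy hwy
    obtain ⟨q, hq, hpq, hqy⟩ := hS.exists_between hκ hp hy hpy
    have hxw := hxz.trans hzw
    have key : ∀ v ∈ S, w < v → v < y → (z.restrict β).snoc true ⊆ v := fun v hv hwv hvy =>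
      hsnoc _ v hv (hxw.trans hwv) hvy (get_eq_true_of_lt (fun γ hγ =>
        (agree w hw hxw hwy γ hγ).trans (agree v hv (hxw.trans hwv) hvy γ hγ).symm) hwv hwβ)
    exact ⟨p, hp, q, hq, hax.trans (hxw.trans hwp), hpq, hqy.trans hyb,
      key p hp hwp hpy, key q hq (hwp.trans hpq) hqy⟩

end Dense

/-! ### Recursion along a well-order of the indices -/

/-- Recursion by choice along a well-founded relation. -/
theorem WellFounded.exists_forall_spec {α : Type*} {β : Type*} [Nonempty β] {r : α → α → Prop}
    (hr : WellFounded r) (P : (α → β) → α → β → Prop)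
    (hP : ∀ F G s, (∀ t, r t s → F t = G t) → P F s = P G s) :
    ∃ F : α → β, ∀ s, (∃ d, P F s d) → P F s (F s) := by
  classical
  let step : ∀ s, (∀ t, r t s → β) → β := fun s f =>
    -- The arbitrary value at non-predecessors is harmless, since by `hP` the condition at `s` does
    -- not see it.
    Classical.epsilon (P (fun t => if h : r t s then f t h else Classical.arbitrary β) s)
  refine ⟨hr.fix step, fun s h => ?_⟩
  have he : hr.fix step s = Classical.epsilon (P (hr.fix step) s) := by
    rw [hr.fix_eq]
    refine congrArg Classical.epsilon (hP _ _ s fun t ht => ?_)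
    simp only [ht, dif_pos]
  rw [he]
  exact Classical.epsilon_spec h

/-- Sequences have a well-order that compares lengths first. -/
theorem BinSeq.exists_wellFounded_length :
    ∃ r : BinSeq.{u} → BinSeq.{u} → Prop, WellFounded r ∧
      (∀ s t, s.length < t.length → r s t) ∧ (∀ s t, r s t → s.length ≤ t.length) ∧
      ∀ s t, s ≠ t → r s t ∨ r t s := by
  refine ⟨fun s t => Prod.Lex (· < ·) WellOrderingRel (s.length, s) (t.length, t),
    InvImage.wf (fun s : BinSeq.{u} => (s.length, s))
      (WellFounded.prod_lex wellFounded_lt WellOrderingRel.isWellOrder.wf),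
    fun s t h => Prod.Lex.left _ _ h, fun s t h => ?_, fun s t h => ?_⟩
  · rcases Prod.lex_def.1 h with h | h
    exacts [h.le, h.1.le]
  · simp only [Prod.lex_def]
    rcases lt_trichotomy s.length t.length with h1 | h1 | h1
    · exact Or.inl (Or.inl h1)
    · rcases trichotomous_of WellOrderingRel s t with h2 | h2 | h2
      · exact Or.inl (Or.inr ⟨h1, h2⟩)
      · exact absurd h2 h
      · exact Or.inr (Or.inr ⟨h1.symm, h2⟩)
    · exact Or.inr (Or.inl h1)

/-! ### Splitting nodes, points and nested intervals -/

/-- The data attached to a node of the index tree: two splitting nodes, a point of the dense set,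
and the end points of the intervals that will contain everything indexed above the two
successors. -/
structure SplitData : Type (u + 1) where
  lower : BinSeq.{u}
  upper : BinSeq.{u}
  point : BinSeq.{u}
  left : Bool → BinSeq.{u}
  right : Bool → BinSeq.{u}

namespace SplitData

instance : Nonempty SplitData.{u} :=
  ⟨let s := ofFun 0 fun _ => false; ⟨s, s, s, fun _ => s, fun _ => s⟩⟩

/-- The points that lie in all intervals chosen along `s`. -/
def cell (F : BinSeq.{u} → SplitData.{u}) (s : BinSeq.{u}) : Set BinSeq.{u} :=
  {x | ∀ γ < s.length, ∀ b, s.get γ = some b →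
    (F (s.restrict γ)).left b < x ∧ x < (F (s.restrict γ)).right b}

/-- `d` is a correct choice of data at `s`, given the data `F` at the predecessors of `s`. -/
structure IsChoice (S : Set BinSeq.{u}) (r : BinSeq.{u} → BinSeq.{u} → Prop)
    (F : BinSeq.{u} → SplitData.{u}) (s : BinSeq.{u}) (d : SplitData.{u}) : Prop where
  left_mem : ∀ b, d.left b ∈ S ∩ cell F s
  right_mem : ∀ b, d.right b ∈ S ∩ cell F s
  left_lt_right : ∀ b, d.left b < d.right b
  point_mem : d.point ∈ S ∩ cell F s
  lower_left : d.lower.snoc false ⊆ d.left false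
  lower_right : d.lower.snoc false ⊆ d.right false
  lower_point : d.lower.snoc true ⊆ d.point
  lower_left' : d.lower.snoc true ⊆ d.left true
  lower_right' : d.lower.snoc true ⊆ d.right true
  upper_point : d.upper.snoc false ⊆ d.point
  upper_left : d.upper.snoc true ⊆ d.left true
  upper_right : d.upper.snoc true ⊆ d.right true
  lower_lt_upper : d.lower.length < d.upper.length
  length_lt : ∀ t, r t s → (F t).point.length < d.lower.length

theorem cell_congr {F G : BinSeq.{u} → SplitData.{u}} {s : BinSeq.{u}}
    (h : ∀ γ < s.length, F (s.restrict γ) = G (s.restrict γ)) : cell F s = cell G s := by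
  ext x
  refine forall₂_congr fun γ hγ => ?_
  rw [h γ hγ]

/-- The cell of `s` consults only proper restrictions of `s`, which are shorter and so precede `s`.
This is the locality needed for the recursion. -/
theorem isChoice_congr {S : Set BinSeq.{u}} {r : BinSeq.{u} → BinSeq.{u} → Prop}
    (hr : ∀ s t : BinSeq.{u}, s.length < t.length → r s t) (F G : BinSeq.{u} → SplitData.{u})
    (s : BinSeq.{u}) (h : ∀ t, r t s → F t = G t) : IsChoice S r F s = IsChoice S r G s := by
  have key : ∀ F G : BinSeq.{u} → SplitData.{u}, (∀ t, r t s → F t = G t) →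
      ∀ d, IsChoice S r F s d → IsChoice S r G s d := by
    intro F G h d hd
    have hc : cell F s = cell G s := cell_congr fun γ hγ =>
      h _ (hr _ _ (by rwa [restrict_length hγ.le]))
    obtain ⟨h1, h2, h3, h4, h5, h6, h7, h8, h9, h10, h11, h12, h13, h14⟩ := hd
    rw [hc] at h1 h2 h4
    exact ⟨h1, h2, h3, h4, h5, h6, h7, h8, h9, h10, h11, h12, h13,
      fun t ht => h t ht ▸ h14 t ht⟩
  funext d
  exact propext ⟨key F G h d, key G F (fun t ht => (h t ht).symm) d⟩

section Choice

variable {κ : Cardinal.{u}} {S : Set BinSeq.{u}} {r : BinSeq.{u} → BinSeq.{u} → Prop}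
  {F : BinSeq.{u} → SplitData.{u}} {s : BinSeq.{u}}

/-- The intervals along `s` are nested, so every left end lies below every right end, and there are
fewer than `κ` of them. Density gives one point of the cell, and a second one above it. -/
theorem exists_lt_mem_cell (hκ : κ.IsInaccessible) (hS : IsKappaDense κ S)
    (hs : s ∈ binTree κ)
    (hF : ∀ γ < s.length, IsChoice S r F (s.restrict γ) (F (s.restrict γ))) :
    ∃ a ∈ S ∩ cell F s, ∃ b ∈ S ∩ cell F s, a < b := by
  let c : Ordinal.{u} → Bool := fun γ => (s.get γ).getD false
  let p : Ordinal.{u} → BinSeq.{u} := fun γ => (F (s.restrict γ)).left (c γ)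
  let q : Ordinal.{u} → BinSeq.{u} := fun γ => (F (s.restrict γ)).right (c γ)
  have hcs : ∀ γ < s.length, s.get γ = some (c γ) := by
    intro γ hγ
    simp only [c, get_of_lt hγ, Option.getD_some]
  have hcell : ∀ x, x ∈ cell F s ↔ ∀ γ < s.length, p γ < x ∧ x < q γ := by
    intro x
    refine forall₂_congr fun γ hγ => ?_
    rw [hcs γ hγ]
    exact ⟨fun h => h _ rfl, fun h b hb => Option.some.inj hb ▸ h⟩
  have hstep : ∀ γ δ, γ < δ → δ < s.length → ∀ x ∈ cell F (s.restrict δ), p γ < x ∧ x < q γ := by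
    intro γ δ hγδ hδ x hx
    have := hx γ (by rwa [restrict_length hδ.le]) (c γ)
      (by rw [restrict_get _ _ _ hγδ, hcs γ (hγδ.trans hδ)])
    rwa [restrict_restrict _ hγδ.le] at this
  have hpq : ∀ γ < s.length, ∀ δ < s.length, p γ < q δ := by
    intro γ hγ δ hδ
    rcases lt_trichotomy γ δ with h | rfl | h
    · exact (hstep γ δ h hδ _ ((hF δ hδ).right_mem _).2).1
    · exact (hF γ hγ).left_lt_right _
    · exact (hstep δ γ h hγ _ ((hF γ hγ).left_mem _).2).2
  have hI : Cardinal.mk (Set.Iio s.length) < Cardinal.lift.{u + 1} κ := by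
    rw [Cardinal.mk_Iio_ordinal, Cardinal.lift_lt, ← Cardinal.lt_ord]
    exact hs
  have h0 : Cardinal.aleph0 < Cardinal.lift.{u + 1} κ := by simpa using hκ.aleph0_lt
  have hA : p '' Set.Iio s.length ⊆ S := by
    rintro _ ⟨γ, hγ, rfl⟩
    exact ((hF γ hγ).left_mem _).1
  have hB : q '' Set.Iio s.length ⊆ S := by
    rintro _ ⟨γ, hγ, rfl⟩
    exact ((hF γ hγ).right_mem _).1
  have hAc := (Cardinal.mk_image_le (f := p)).trans_lt hI
  have hBc := (Cardinal.mk_image_le (f := q)).trans_lt hI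
  obtain ⟨a, ha, ha1, ha2⟩ := isKappaDense_coe_iff.1 hS _ _ hA hB hAc hBc (by
    rintro _ ⟨γ, hγ, rfl⟩ _ ⟨δ, hδ, rfl⟩
    exact hpq γ hγ δ hδ)
  obtain ⟨b, hb, hb1, hb2⟩ := isKappaDense_coe_iff.1 hS (insert a (p '' Set.Iio s.length)) _
    (Set.insert_subset ha hA) hB
    (Cardinal.mk_insert_le.trans_lt
      (Cardinal.add_lt_of_lt h0.le hAc (Cardinal.one_lt_aleph0.trans h0))) hBc (by
    rintro _ (rfl | ⟨γ, hγ, rfl⟩) _ ⟨δ, hδ, rfl⟩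
    · exact ha2 _ ⟨δ, hδ, rfl⟩
    · exact hpq γ hγ δ hδ)
  refine ⟨a, ⟨ha, (hcell a).2 fun γ hγ => ⟨ha1 _ ⟨γ, hγ, rfl⟩, ha2 _ ⟨γ, hγ, rfl⟩⟩⟩,
    b, ⟨hb, (hcell b).2 fun γ hγ =>
      ⟨hb1 _ (Or.inr ⟨γ, hγ, rfl⟩), hb2 _ ⟨γ, hγ, rfl⟩⟩⟩, hb1 a (Or.inl rfl)⟩

theorem mem_cell_of_mem_Icc {a b x : BinSeq.{u}} (ha : a ∈ cell F s) (hb : b ∈ cell F s)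
    (hax : a ≤ x) (hxb : x ≤ b) : x ∈ cell F s := fun γ hγ c hc =>
  ⟨(ha γ hγ c hc).1.trans_le hax, hxb.trans_lt (hb γ hγ c hc).2⟩

theorem exists_isChoice (hκ : κ.IsInaccessible) (hSκ : S ⊆ binTree κ) (hS : IsKappaDense κ S)
    (hr1 : ∀ s t : BinSeq.{u}, s.length < t.length → r s t)
    (hr2 : ∀ s t, r s t → s.length ≤ t.length) (hs : s ∈ binTree κ)
    (hF : ∀ t, r t s → IsChoice S r F t (F t)) : ∃ d, IsChoice S r F s d := by
  obtain ⟨a, ha, b, hb, hab⟩ := exists_lt_mem_cell hκ hS hs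
    (fun γ hγ => hF _ (hr1 _ _ (by rwa [restrict_length hγ.le])))
  obtain ⟨l, hl, hl'⟩ := exists_length_bound hκ (X := {t | r t s})
    ((Cardinal.mk_le_mk_of_subset fun t ht => hr2 t s ht).trans_lt
      (mk_setOf_length_le_lt hκ hs)) (f := fun t => (F t).point.length)
    (fun t ht => hSκ (hF t ht).point_mem.1)
  obtain ⟨m, hlm, hm⟩ := hS.exists_split hκ ha.1 hb.1 hab hl
  obtain ⟨p, hp, q, hq, hap, hpq, hqb, hmp, hmq⟩ := hm false
  obtain ⟨p', hp', q', hq', hap', hpq', hqb', hmp', hmq'⟩ := hm true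
  -- The second split takes place inside the right cone of `m`. The successor makes `n` strictly
  -- longer than `m`, and convexity keeps the new points above `m` followed by 1.
  obtain ⟨n, hmn, hn⟩ := hS.exists_split hκ hp' hq' hpq' (l := Order.succ m.length)
    ((Cardinal.isSuccLimit_ord hκ.aleph0_lt.le).succ_lt
      ((length_lt_of_snoc_subset hmp).trans (hSκ hp)))
  obtain ⟨x, hx, x', hx', hpx, hxx, hxq, hnx, -⟩ := hn false
  obtain ⟨y, hy, z, hz, hpy, hyz, hzq, hny, hnz⟩ := hn true
  have hcell : ∀ v, a < v → v < b → v ∈ cell F s := fun v h1 h2 =>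
    mem_cell_of_mem_Icc ha.2 hb.2 h1.le h2.le
  have hcone : ∀ v, p' < v → v < q' → m.snoc true ⊆ v := fun v h1 h2 =>
    subset_of_mem_Icc hmp' hmq' h1.le h2.le
  have hxq' := hxx.trans hxq
  have hyq' := hyz.trans hzq
  have hpz := hpy.trans hyz
  refine ⟨⟨m, n, x, fun c => bif c then y else p, fun c => bif c then z else q⟩, ?_⟩
  constructor
  · rintro (_ | _)
    · exact ⟨hp, hcell p hap (hpq.trans hqb)⟩
    · exact ⟨hy, hcell y (hap'.trans hpy) (hyq'.trans hqb')⟩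
  · rintro (_ | _)
    · exact ⟨hq, hcell q (hap.trans hpq) hqb⟩
    · exact ⟨hz, hcell z (hap'.trans hpz) (hzq.trans hqb')⟩
  · rintro (_ | _)
    exacts [hpq, hyz]
  · exact ⟨hx, hcell x (hap'.trans hpx) (hxq'.trans hqb')⟩
  · exact hmp
  · exact hmq
  · exact hcone x hpx hxq'
  · exact hcone y hpy hyq'
  · exact hcone z hpz hzq
  · exact hnx
  · exact hny
  · exact hnz
  · exact (Order.lt_succ _).trans_le hmn
  · exact fun t ht => (hl' t ht).trans_le hlm

/-- Let `w` be the common part of `s` and `t` below their first difference. If `s` ends there,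
`upper` at `w` separates its point from the right interval. Otherwise `s` turns left and `lower`
separates the left interval from both the point and the right interval. -/
theorem exists_split_of_lt (hF : ∀ s ∈ binTree κ, IsChoice S r F s (F s)) {t : BinSeq.{u}}
    (hs : s ∈ binTree κ) (ht : t ∈ binTree κ) (hst : s < t) :
    ∃ w ∈ binTree κ, ∃ m, (m = (F w).lower ∨ m = (F w).upper) ∧
      m.snoc false ⊆ (F s).point ∧ m.snoc true ⊆ (F t).point := by
  obtain ⟨β, h1, h2⟩ := lt_iff_firstDiffLT.1 hst
  have hw : s.restrict β = t.restrict β := restrict_congr h1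
  have hwκ : s.restrict β ∈ binTree κ :=
    show (s.restrict β).length < κ.ord from (min_le_right _ _).trans_lt hs
  have hchoice := hF _ hwκ
  have hmem : ∀ v ∈ binTree κ, v.restrict β = s.restrict β → ∀ b, v.get β = some b →
      (F (s.restrict β)).left b ≤ (F v).point ∧ (F v).point ≤ (F (s.restrict β)).right b := by
    intro v hv hvs b hb
    have hβ : β < v.length := by
      by_contra! hc
      rw [get_of_le hc] at hb
      cases hb
    have := (hF v hv).point_mem.2 β hβ b hb
    rw [hvs] at this
    exact ⟨this.1.le, this.2.le⟩
  have hnone : ∀ v : BinSeq.{u}, v.restrict β = s.restrict β → v.get β = none →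
      s.restrict β = v := by
    intro v hvs hv
    rw [← hvs]
    refine ext_get fun γ => ?_
    rcases lt_or_ge γ β with hγ | hγ
    · exact restrict_get v β γ hγ
    · rw [get_of_le ((get_eq_none_iff.1 hv).trans hγ), get_of_le ((min_le_left _ _).trans hγ)]
  rcases hsβ : s.get β with _ | _ | _ <;> rcases htβ : t.get β with _ | _ | _ <;>
    simp only [hsβ, htβ, digitRank] at h2 <;> try omega
  · obtain ⟨h3, h4⟩ := hmem t ht hw.symm true htβ
    refine ⟨_, hwκ, _, Or.inr rfl, ?_,
      subset_of_mem_Icc hchoice.upper_left hchoice.upper_right h3 h4⟩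
    have := hchoice.upper_point
    rwa [hnone s rfl hsβ] at this ⊢
  · obtain ⟨h3, h4⟩ := hmem s hs rfl false hsβ
    refine ⟨_, hwκ, _, Or.inl rfl,
      subset_of_mem_Icc hchoice.lower_left hchoice.lower_right h3 h4, ?_⟩
    have := hchoice.lower_point
    rwa [hnone t hw.symm htβ] at this ⊢
  · obtain ⟨h3, h4⟩ := hmem s hs rfl false hsβ
    obtain ⟨h5, h6⟩ := hmem t ht hw.symm true htβ
    exact ⟨_, hwκ, _, Or.inl rfl,
      subset_of_mem_Icc hchoice.lower_left hchoice.lower_right h3 h4,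
      subset_of_mem_Icc hchoice.lower_left' hchoice.lower_right' h5 h6⟩

end Choice

end SplitData

/-! ### Density and diagonality of the set of points -/

namespace SplitData

variable {κ : Cardinal.{u}} {S : Set BinSeq.{u}} {r : BinSeq.{u} → BinSeq.{u} → Prop}
  {F : BinSeq.{u} → SplitData.{u}}

theorem point_lt_point (hF : ∀ s ∈ binTree κ, IsChoice S r F s (F s)) {s t : BinSeq.{u}}
    (hs : s ∈ binTree κ) (ht : t ∈ binTree κ) (hst : s < t) : (F s).point < (F t).point := by
  obtain ⟨-, -, m, -, h1, h2⟩ := exists_split_of_lt hF hs ht hst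
  exact lt_of_snoc_subset h1 h2

theorem injOn_point (hF : ∀ s ∈ binTree κ, IsChoice S r F s (F s)) :
    Set.InjOn (fun s => (F s).point) (binTree κ) := by
  intro s hs t ht h
  rcases lt_trichotomy s t with hst | hst | hst
  · exact absurd h (point_lt_point hF hs ht hst).ne
  · exact hst
  · exact absurd h (point_lt_point hF ht hs hst).ne'

/-- The points form an ordered copy of the tree. Small sets of points have indices of bounded
length, so a cut between them is filled in the tree. -/
theorem isKappaDense_image_point (hκ : κ.IsInaccessible)
    (hF : ∀ s ∈ binTree κ, IsChoice S r F s (F s)) :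
    IsKappaDense κ ((fun s => (F s).point) '' binTree κ) := by
  have hpre : ∀ A ⊆ (fun s => (F s).point) '' binTree κ,
      Cardinal.mk A < Cardinal.lift.{u + 1} κ → ∃ l < κ.ord,
        ∀ s ∈ binTree κ ∩ (fun s => (F s).point) ⁻¹' A, s.length < l := by
    intro A hA hAκ
    refine exists_length_bound hκ (lt_of_le_of_lt ?_ hAκ) fun s hs => hs.1
    refine Cardinal.mk_le_of_injective
      (f := fun s : ↑(binTree κ ∩ (fun s => (F s).point) ⁻¹' A) => (⟨(F s.1).point, s.2.2⟩ : A))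
      fun s t hst => Subtype.ext (injOn_point hF s.2.1 t.2.1 (congrArg Subtype.val hst))
  refine isKappaDense_coe_iff.2 fun A B hA hB hAκ hBκ hAB => ?_
  obtain ⟨l, hl, hAl⟩ := hpre A hA hAκ
  obtain ⟨l', hl', hBl⟩ := hpre B hB hBκ
  obtain ⟨c, hc, hAc, hcB⟩ := exists_between_binTree (l := max l l')
    (A := binTree κ ∩ (fun s => (F s).point) ⁻¹' A)
    (B := binTree κ ∩ (fun s => (F s).point) ⁻¹' B)
    (fun a ha => (hAl a ha).trans_le (le_max_left _ _))
    (fun b hb => (hBl b hb).trans_le (le_max_right _ _)) (by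
      intro a ha b hb
      by_contra! hba
      rcases hba.eq_or_lt with rfl | hba
      · exact lt_irrefl _ (hAB _ ha.2 _ hb.2)
      · exact lt_asymm (point_lt_point hF hb.1 ha.1 hba) (hAB _ ha.2 _ hb.2))
  have hcκ : c ∈ binTree κ := show c.length < κ.ord from hc ▸ max_lt hl hl'
  refine ⟨_, ⟨c, hcκ, rfl⟩, fun a ha => ?_, fun b hb => ?_⟩
  · obtain ⟨s, hs, rfl⟩ := hA ha
    exact point_lt_point hF hs hcκ (hAc s ⟨hs, ha⟩)
  · obtain ⟨s, hs, rfl⟩ := hB hb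
    exact point_lt_point hF hcκ hs (hcB s ⟨hs, hb⟩)

/-- The meet closure consists of nodes `lower`, `upper` and `point`. Their lengths increase strictly
within one index, and all those of an earlier index lie below those of a later one. -/
theorem isDiagonal_image_point (hr : ∀ s t, s ≠ t → r s t ∨ r t s)
    (hF : ∀ s ∈ binTree κ, IsChoice S r F s (F s)) :
    IsDiagonal ((fun s => (F s).point) '' binTree κ) := by
  have hsplit : ∀ s ∈ binTree κ, ∀ t ∈ binTree κ, s ≠ t → ∃ w ∈ binTree κ, ∃ m,
      (m = (F w).lower ∨ m = (F w).upper) ∧ ∃ b c : Bool, b ≠ c ∧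
        m.snoc b ⊆ (F s).point ∧ m.snoc c ⊆ (F t).point := by
    intro s hs t ht hne
    rcases lt_or_gt_of_ne hne with h | h
    · obtain ⟨w, hw, m, hm, h1, h2⟩ := exists_split_of_lt hF hs ht h
      exact ⟨w, hw, m, hm, false, true, nofun, h1, h2⟩
    · obtain ⟨w, hw, m, hm, h1, h2⟩ := exists_split_of_lt hF ht hs h
      exact ⟨w, hw, m, hm, true, false, nofun, h2, h1⟩
  constructor
  · rintro _ ⟨s, hs, rfl⟩ _ ⟨t, ht, rfl⟩ hne
    obtain ⟨-, -, m, -, b, c, hbc, h1, h2⟩ := hsplit s hs t ht fun h => hne (h ▸ rfl)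
    exact incomparable_of_snoc_subset hbc h1 h2
  · have hmem : ∀ x ∈ meetClosure ((fun s => (F s).point) '' binTree κ), ∃ w ∈ binTree κ,
        x = (F w).lower ∨ x = (F w).upper ∨ x = (F w).point := by
      rintro _ ⟨_, ⟨s, hs, rfl⟩, _, ⟨t, ht, rfl⟩, rfl⟩
      by_cases hst : s = t
      · subst hst
        exact ⟨s, hs, Or.inr (Or.inr (meet_self _))⟩
      · obtain ⟨w, hw, m, hm, b, c, hbc, h1, h2⟩ := hsplit s hs t ht hst
        refine ⟨w, hw, ?_⟩
        rw [meet_eq_of_snoc_subset hbc h1 h2]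
        exact hm.imp_right Or.inl
    have hupper : ∀ w ∈ binTree κ, (F w).upper.length < (F w).point.length := fun w hw =>
      length_lt_of_snoc_subset (hF w hw).upper_point
    have hbounds : ∀ w ∈ binTree κ, ∀ x, (x = (F w).lower ∨ x = (F w).upper ∨ x = (F w).point) →
        (F w).lower.length ≤ x.length ∧ x.length ≤ (F w).point.length := by
      intro w hw x hx
      have h1 := (hF w hw).lower_lt_upper
      have h2 := hupper w hw
      rcases hx with rfl | rfl | rfl
      exacts [⟨le_rfl, (h1.trans h2).le⟩, ⟨h1.le, h2.le⟩, ⟨(h1.trans h2).le, le_rfl⟩]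
    intro x hx y hy hxy
    obtain ⟨w, hw, hxw⟩ := hmem x hx
    obtain ⟨v, hv, hyv⟩ := hmem y hy
    by_cases hwv : w = v
    · subst hwv
      have h1 := (hF w hw).lower_lt_upper
      have h2 := hupper w hw
      have h3 := h1.trans h2
      rcases hxw with rfl | rfl | rfl <;> rcases hyv with rfl | rfl | rfl
      exacts [absurd rfl hxy, h1.ne, h3.ne, h1.ne', absurd rfl hxy, h2.ne, h3.ne', h2.ne',
        absurd rfl hxy]
    · obtain ⟨hx1, hx2⟩ := hbounds w hw x hxw
      obtain ⟨hy1, hy2⟩ := hbounds v hv y hyv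
      rcases hr w v hwv with h | h
      · exact ((hx2.trans_lt ((hF v hv).length_lt w h)).trans_le hy1).ne
      · exact ((hy2.trans_lt ((hF w hw).length_lt v h)).trans_le hx1).ne'

end SplitData

open SplitData

theorem mainTheorem10 (κ : Cardinal.{u}) (hκ : κ.IsInaccessible)
    (hlim : ∀ μ < κ, ∃ ν : Cardinal.{u}, ν.IsInaccessible ∧ μ < ν ∧ ν < κ)
    (S : Set BinSeq.{u}) (hS : S ⊆ binTree κ) (hdense : IsKappaDense κ S) :
    ∃ D : Set BinSeq.{u}, D ⊆ S ∧ IsDiagonal D ∧ IsKappaDense κ D := by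
  obtain ⟨r, hwf, hr1, hr2, hr3⟩ := BinSeq.exists_wellFounded_length.{u}
  obtain ⟨F, hF⟩ := hwf.exists_forall_spec (IsChoice S r) (isChoice_congr hr1)
  -- `F` is correct at `s` only if a correct choice exists there. Predecessors of `s` are no longer
  -- than `s`, hence in the tree, so induction supplies it.
  have hchoice : ∀ s ∈ binTree κ, IsChoice S r F s (F s) := by
    intro s
    induction s using hwf.induction with
    | _ s ih =>
      intro hs
      exact hF s (exists_isChoice hκ hS hdense hr1 hr2 hs fun t ht =>
        ih t ht (show t.length < κ.ord from (hr2 t s ht).trans_lt hs))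
  refine ⟨_, ?_, isDiagonal_image_point hr3 hchoice, isKappaDense_image_point hκ hchoice⟩
  rintro _ ⟨s, hs, rfl⟩
  exact (hchoice s hs).point_mem.1
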